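/- Let $w$ be the space of all sequences $x=(x_n)_{n\ge 0}$ with entries in $\mathbb K$, where $\mathbb K$ is $\mathbb R$ or $\mathbb C$. For $U\subseteq w$ the $\alpha$-dual of $U$ is $U^\alpha=\{a\in w:\ \sum_n |a_nx_n|<\infty \text{ for all } x\in U\}$. Let $p=(p_k)_{k\ge0}$ be a bounded sequence of strictly positive real numbers, and put $$l(p)=\Big\{x\in w:\sum_k|x_k|^{p_k}<\infty\Big\},\qquad c_0(p)=\Big\{x\in w:\lim_k|x_k|^{p_k}=0\Big\},$$ $$c(p)=\Big\{x\in w:\lim_k|x_k-l|^{p_k}=0\text{ for some } l\in\mathbb K\Big\},\qquad l_\infty(p)=\Big\{x\in w:\sup_k|x_k|^{p_k}<\infty\Big\}.$$ Let $r,s,t\in w$ with $r_n\ne0$ and $t_n\neq 0$ for all $n$ and $s_0\ne0$, and let $u,v\in\mathbb K$ be nonzero. For $X(p)\in\{l(p),c_0(p),c(p),l_\infty(p)\}$ let $X(r,s,t,p;B)$ be the set of all $x\in w$ such that the sequence $y$ given by $$y_n=\frac1{r_n}\Big(\sum_{k=0}^{n-1}(s_{n-k}t_ku+s_{n-k-1}t_{k+1}v)x_k+s_0t_nu\,x_n\Big)\qquad(n\ge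 0)$$ belongs to $X(p)$. Let $D^{(s)}_0=1/s_0$ and, for $n\ge1$, $D^{(s)}_n=s_0^{-(n+1)}\det(\sigma_{i-j+1})_{i,j=1}^n$, where $\sigma_m=s_m$ for $m\ge0$ and $\sigma_m=0$ for $m<0$. For $a\in w$ and $n,k\ge0$ put $$c_{nk}=c_{nk}(a)=\sum_{j=k}^n(-1)^{j-k}\frac{(-v)^{n-j}}{u^{n-j+1}}\frac{D^{(s)}_{j-k}}{t_j}r_ka_n,$$ so that $c_{nk}=0$ for $k>n$. With $L$ ranging over the positive integers, $F$ over the nonempty finite sets of nonnegative integers, and $p_k'=p_k/(p_k-1)$ when $p_k>1$, define $$H_1(p)=\Big\{a\in w:\ \sup_F\sum_n\Big|\sum_{k\in F}c_{nk}L^{-1/p_k}\Big|<\infty\text{ for some }L\Big\},\qquad H_2(p)=\Big\{a\in w:\ \sum_n\Big|\sum_kc_{nk}\Big|<\infty\Big\},$$ $$H_3(p)=\Big\{a\in w:\ \sup_F\sum_n\Big|\sum_{k\in F}c_{nk}L^{1/p_k}\Big|<\infty\text{ for every }L\Big\},\qquad H_4(p)=\Big\{a\in w:\ \sup_F\sup_k\Big|\sum_{n\in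 F}c_{nk}\Big|^{p_k}<\infty\Big\},$$ and, when $p_k>1$ for all $k$, $$H_5(p)=\Big\{a\in w:\ \sup_F\sum_k\Big|\sum_{n\in F}c_{nk}L^{-1}\Big|^{p_k'}<\infty\text{ for some }L\Big\}.$$ **Theorem.** (a) If $p_k>1$ for all $k$, then $[l(r,s,t,p;B)]^\alpha=H_5(p)$. If $0<p_k\le1$ for all $k$, then $[l(r,s,t,p;B)]^\alpha=H_4(p)$. (b) For every bounded sequence $p$ of strictly positive reals, (i) $[c_0(r,s,t,p;B)]^\alpha=H_1(p)$; (ii) $[c(r,s,t,p;B)]^\alpha=H_1(p)\cap H_2(p)$; (iii) $[l_\infty(r,s,t,p;B)]^\alpha=H_3(p)$. -/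

import Mathlib

open Filter Topology
open scoped ENNReal

namespace GenMeanDiff

noncomputable section

/- Sequences indexed by the nonnegative integers with entries in `𝕜` (the real or the complex field)
are functions `ℕ → 𝕜`; the space of all of them is the type `ℕ → 𝕜`. -/

/-! ### Multiplier spaces and the α-dual -/

/-- The space `l₁` of absolutely summable sequences. -/
def ellOne (𝕜 : Type*) [RCLike 𝕜] : Set (ℕ → 𝕜) :=
  {x | Summable fun n => ‖x n‖}

/-- The multiplier space `M(U, V)`: all `a` such that `(aₙ xₙ) ∈ V` for every `x ∈ U`. -/
def multiplier {𝕜 : Type*} [RCLike 𝕜] (U V : Set (ℕ → 𝕜)) : Set (ℕ → 𝕜) :=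
  {a | ∀ x ∈ U, (fun n => a n * x n) ∈ V}

/-- The α-dual `M(U, l₁)` of a set `U` of sequences. -/
def alphaDual {𝕜 : Type*} [RCLike 𝕜] (U : Set (ℕ → 𝕜)) : Set (ℕ → 𝕜) :=
  multiplier U (ellOne 𝕜)

/-! ### The sequence spaces of Maddox -/

/-- `l(p)`: the series `∑ |x_k| ^ p_k` converges. -/
def maddoxL (𝕜 : Type*) [RCLike 𝕜] (p : ℕ → ℝ) : Set (ℕ → 𝕜) :=
  {x | Summable fun k => ‖x k‖ ^ p k}

/-- `c₀(p)`: `|x_k| ^ p_k → 0`. -/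
def maddoxC0 (𝕜 : Type*) [RCLike 𝕜] (p : ℕ → ℝ) : Set (ℕ → 𝕜) :=
  {x | Tendsto (fun k => ‖x k‖ ^ p k) atTop (𝓝 0)}

/-- `c(p)`: `|x_k - l| ^ p_k → 0` for some scalar `l`. -/
def maddoxC (𝕜 : Type*) [RCLike 𝕜] (p : ℕ → ℝ) : Set (ℕ → 𝕜) :=
  {x | ∃ l : 𝕜, Tendsto (fun k => ‖x k - l‖ ^ p k) atTop (𝓝 0)}

/-- `l_∞(p)`: `sup_k |x_k| ^ p_k < ∞`. -/
def maddoxLInf (𝕜 : Type*) [RCLike 𝕜] (p : ℕ → ℝ) : Set (ℕ → 𝕜) :=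
  {x | BddAbove (Set.range fun k => ‖x k‖ ^ p k)}

/-! ### Generalized means of the `B(u, v)`-difference -/

/-- The `A(r, s, t; B)`-transform `y` of `x`, where `A(r, s, t; B) = A(r, s, t) · B(u, v)`:
`y_n = (1 / r_n) (∑_{k < n} (s_{n-k} t_k u + s_{n-k-1} t_{k+1} v) x_k + s_0 t_n u x_n)`. -/
def transform {𝕜 : Type*} [RCLike 𝕜] (r s t : ℕ → 𝕜) (u v : 𝕜) (x : ℕ → 𝕜) : ℕ → 𝕜 :=
  fun n => (1 / r n) *
    ((∑ k ∈ Finset.range n, (s (n - k) * t k * u + s (n - k - 1) * t (k + 1) * v) * x k)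
      + s 0 * t n * u * x n)

/-- The sequence space `X(r, s, t; B)`: all `x` whose `A(r, s, t; B)`-transform lies in `X`. -/
def domain {𝕜 : Type*} [RCLike 𝕜] (X : Set (ℕ → 𝕜)) (r s t : ℕ → 𝕜) (u v : 𝕜) :
    Set (ℕ → 𝕜) :=
  {x | transform r s t u v x ∈ X}

/-- `D_n^{(s)} = s_0^{-(n+1)} det M_n`, with `M_n` the `n × n` matrix whose `(i, j)` entry
(indices from `0`) is `s_{i + 1 - j}` if `j ≤ i + 1` and `0` otherwise; `D_0^{(s)} = 1 / s_0`. -/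
def coeffD {𝕜 : Type*} [RCLike 𝕜] (s : ℕ → 𝕜) (n : ℕ) : 𝕜 :=
  (1 / s 0 ^ (n + 1)) *
    (Matrix.of fun i j : Fin n =>
      if (j : ℕ) ≤ (i : ℕ) + 1 then s ((i : ℕ) + 1 - (j : ℕ)) else 0).det

/-- `c_{nk} = ∑_{j=k}^{n} (-1)^{j-k} ((-v)^{n-j} / u^{n-j+1}) (D_{j-k}^{(s)} / t_j) r_k a_n`;
the sum is empty, and `c_{nk} = 0`, when `k > n`. -/
def dualEntry {𝕜 : Type*} [RCLike 𝕜] (r s t : ℕ → 𝕜) (u v : 𝕜) (a : ℕ → 𝕜) (n k : ℕ) : 𝕜 :=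
  ∑ j ∈ Finset.Icc k n,
    (-1) ^ (j - k) * ((-v) ^ (n - j) / u ^ (n - j + 1)) * (coeffD s (j - k) / t j) * r k * a n

/-! ### The sets `H₁(p), …, H₅(p)`

Suprema and sums of nonnegative terms are taken in `[0, ∞]`. The number `L` is a positive integer
and `F` a nonempty finite set of indices. -/

/-- `H₁(p)`: for some `L`, `sup_F ∑_n |∑_{k ∈ F} c_{nk} L^{-1/p_k}| < ∞`. -/
def H1 {𝕜 : Type*} [RCLike 𝕜] (r s t : ℕ → 𝕜) (u v : 𝕜) (p : ℕ → ℝ) : Set (ℕ → 𝕜) :=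
  {a | ∃ L : ℕ, 1 ≤ L ∧
    (⨆ (F : Finset ℕ) (_ : F.Nonempty), ∑' n,
      ‖∑ k ∈ F, dualEntry r s t u v a n k * (((L : ℝ) ^ (-1 / p k) : ℝ) : 𝕜)‖ₑ) < ∞}

/-- `H₂(p)`: `∑_n |∑_k c_{nk}| < ∞`; only the terms with `k ≤ n` can be nonzero. -/
def H2 {𝕜 : Type*} [RCLike 𝕜] (r s t : ℕ → 𝕜) (u v : 𝕜) : Set (ℕ → 𝕜) :=
  {a | (∑' n, ‖∑ k ∈ Finset.range (n + 1), dualEntry r s t u v a n k‖ₑ) < ∞}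

/-- `H₃(p)`: for every `L`, `sup_F ∑_n |∑_{k ∈ F} c_{nk} L^{1/p_k}| < ∞`. -/
def H3 {𝕜 : Type*} [RCLike 𝕜] (r s t : ℕ → 𝕜) (u v : 𝕜) (p : ℕ → ℝ) : Set (ℕ → 𝕜) :=
  {a | ∀ L : ℕ, 1 ≤ L →
    (⨆ (F : Finset ℕ) (_ : F.Nonempty), ∑' n,
      ‖∑ k ∈ F, dualEntry r s t u v a n k * (((L : ℝ) ^ (1 / p k) : ℝ) : 𝕜)‖ₑ) < ∞}

/-- `H₄(p)`: `sup_F sup_k |∑_{n ∈ F} c_{nk}| ^ p_k < ∞`. -/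
def H4 {𝕜 : Type*} [RCLike 𝕜] (r s t : ℕ → 𝕜) (u v : 𝕜) (p : ℕ → ℝ) : Set (ℕ → 𝕜) :=
  {a | (⨆ (F : Finset ℕ) (_ : F.Nonempty), ⨆ k,
      ‖∑ n ∈ F, dualEntry r s t u v a n k‖ₑ ^ p k) < ∞}

/-- `H₅(p)`: for some `L`, `sup_F ∑_k |∑_{n ∈ F} c_{nk} L⁻¹| ^ p_k' < ∞`, where
`p_k' = p_k / (p_k - 1)` is the conjugate exponent of `p_k > 1`. -/
def H5 {𝕜 : Type*} [RCLike 𝕜] (r s t : ℕ → 𝕜) (u v : 𝕜) (p : ℕ → ℝ) : Set (ℕ → 𝕜) :=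
  {a | ∃ L : ℕ, 1 ≤ L ∧
    (⨆ (F : Finset ℕ) (_ : F.Nonempty), ∑' k,
      ‖∑ n ∈ F, dualEntry r s t u v a n k * (L : 𝕜)⁻¹‖ₑ ^ (p k / (p k - 1))) < ∞}

end

end GenMeanDiff

/-! The transform is a chain of invertible operations on power series: multiply x by u + vX, scale
termwise by t, multiply by the series of s, divide termwise by r. Inverting the chain gives a_n x_n
= ∑_k c_{nk} y_k with y arbitrary, so by `mem_alphaDual_domain_iff` each claim asks when the
triangle c maps X(p) into l₁.

Sufficiency rests on `sum_smul_le`: if all finite subsums of a family have seminorm at most M, then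
finite sums with coefficients of modulus at most 1 have seminorm at most 4M. Applied to the columns
of c in l₁, it settles c₀(p) and l_∞(p); c(p) is c₀(p) plus the constants. Applied to scalars, it
bounds an l₁-norm by finite subsums, which leaves a column-by-column estimate for l(p) when p_k ≤ 1
and Young's inequality when p_k > 1.

Necessity is a gliding hump (`exists_gliding_hump`). Unit vectors lie in every X(p), so each column
of c is in l₁ and finitely many columns contribute a finite amount. If the condition fails, finite
blocks with arbitrarily large image therefore exist beyond any index, and they can be pasted into a
y in X(p) whose image is not in l₁. Only the size of the j-th block depends on the space:
(j+1)^{-1/p_k} for c₀(p), L^{1/p_k} for l_∞(p), mass 2^{-j} for l(p). -/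

namespace GenMeanDiff

/-! ### Inversion of the transform -/

section Inversion

variable {𝕜 : Type*} [RCLike 𝕜]

/-- The numbers `(-1)^n D_n` are the coefficients of the reciprocal of the power series `s`. -/
theorem mk_coeffD_mul {s : ℕ → 𝕜} (hs : s 0 ≠ 0) :
    PowerSeries.mk (fun n => (-1) ^ n * coeffD s n) * PowerSeries.mk s = 1 := by
  have hs' : PowerSeries.constantCoeff (PowerSeries.mk s) ≠ 0 := by simpa using hs
  have hinv := PowerSeries.inv_mul_cancel _ hs'
  suffices h : PowerSeries.mk (fun n => (-1) ^ n * coeffD s n) = (PowerSeries.mk s)⁻¹ by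
    rw [h, hinv]
  ext n
  set e : ℕ → 𝕜 := fun k => PowerSeries.coeff k (PowerSeries.mk s)⁻¹ with he
  -- The first n + 1 coefficients of 1/s solve a lower triangular Toeplitz system with right side
  -- (1, 0, …, 0).
  let T : Matrix (Fin (n + 1)) (Fin (n + 1)) 𝕜 :=
    Matrix.of fun i j => if (j : ℕ) ≤ i then s (i - j) else 0
  have hdet : T.det = s 0 ^ (n + 1) := by
    rw [Matrix.det_of_isLowerTriangular]
    · simp [T]
    · intro i j hij
      have : i < j := hij
      simp [T, this]
  have hsol : T.mulVec (fun i => e i) = Pi.single 0 1 := by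
    funext i
    have h1 := congrArg (PowerSeries.coeff (i : ℕ)) hinv
    rw [PowerSeries.coeff_mul, Finset.Nat.sum_antidiagonal_eq_sum_range_succ
      (fun a b => PowerSeries.coeff a (PowerSeries.mk s)⁻¹ * PowerSeries.coeff b (PowerSeries.mk s)),
      PowerSeries.coeff_one] at h1
    have h2 : T.mulVec (fun i => e i) i
        = ∑ k ∈ Finset.range (n + 1), if k ≤ (i : ℕ) then e k * s (i - k) else 0 := by
      rw [Matrix.mulVec, dotProduct, ← Fin.sum_univ_eq_sum_range
        (fun k => if k ≤ (i : ℕ) then e k * s (i - k) else 0)]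
      refine Finset.sum_congr rfl fun k _ => ?_
      by_cases hk : (k : ℕ) ≤ i <;> simp only [T, Matrix.of_apply, hk, if_true, if_false, mul_comm, zero_mul]
    rw [h2, ← Finset.sum_filter]
    have h3 : (Finset.range (n + 1)).filter (fun k => k ≤ (i : ℕ)) = Finset.range (i + 1) := by
      ext k; simp; omega
    rw [h3]
    simp only [PowerSeries.coeff_mk] at h1
    rw [h1, Pi.single_apply]
    simp only [Fin.ext_iff, Fin.val_zero]
  -- Cramer's rule for the last unknown: the minor without the first row and last column is the
  -- matrix in `coeffD`, and its cofactor sign is (-1)^n.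
  have hadj := congrFun (congrArg T.adjugate.mulVec hsol) (Fin.last n)
  rw [Matrix.mulVec_mulVec, Matrix.adjugate_mul, hdet, Matrix.smul_mulVec, Matrix.one_mulVec,
    Matrix.mulVec_single_one, Matrix.col_apply, Matrix.adjugate_fin_succ_eq_det_submatrix] at hadj
  have hsub : T.submatrix (Fin.succAbove 0) (Fin.succAbove (Fin.last n))
      = Matrix.of fun i j : Fin n =>
        if (j : ℕ) ≤ (i : ℕ) + 1 then s ((i : ℕ) + 1 - (j : ℕ)) else 0 := by
    ext i j
    simp only [T, Matrix.submatrix_apply, Matrix.of_apply, Fin.succAbove_zero,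
      Fin.succAbove_last, Fin.val_succ, Fin.val_castSucc]
  rw [hsub] at hadj
  simp only [Pi.smul_apply, smul_eq_mul, Fin.val_last, Fin.val_zero, zero_add] at hadj
  have hs0 : s 0 ^ (n + 1) ≠ 0 := pow_ne_zero _ hs
  rw [PowerSeries.coeff_mk, coeffD]
  change _ = e n
  rw [mul_left_comm, ← hadj, one_div, inv_mul_cancel_left₀ hs0]

/-- The geometric series is the reciprocal of `u + v X`. -/
theorem mk_geom_mul {u : 𝕜} (v : 𝕜) (hu : u ≠ 0) :
    PowerSeries.mk (fun n => (-v) ^ n / u ^ (n + 1)) *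
      (PowerSeries.C u + PowerSeries.C v * PowerSeries.X) = 1 := by
  ext n
  rw [mul_add, map_add, PowerSeries.coeff_mul_C, mul_comm (PowerSeries.C v), ← mul_assoc,
    PowerSeries.coeff_mul_C]
  cases n with
  | zero => simp [hu]
  | succ n =>
    simp [PowerSeries.coeff_succ_mul_X, PowerSeries.coeff_one]
    field_simp
    ring

/-- The `B(u, v)`-transform of a sequence, as the coefficients of a product of power series. -/
noncomputable def bTransform (u v : 𝕜) (x : ℕ → 𝕜) (n : ℕ) : 𝕜 :=
  PowerSeries.coeff n ((PowerSeries.C u + PowerSeries.C v * PowerSeries.X) * PowerSeries.mk x)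

theorem bTransform_zero (u v : 𝕜) (x : ℕ → 𝕜) : bTransform u v x 0 = u * x 0 := by
  simp [bTransform]

theorem bTransform_succ (u v : 𝕜) (x : ℕ → 𝕜) (n : ℕ) :
    bTransform u v x (n + 1) = u * x (n + 1) + v * x n := by
  simp [bTransform, add_mul, mul_assoc, PowerSeries.coeff_succ_X_mul]

theorem mk_bTransform (u v : 𝕜) (x : ℕ → 𝕜) :
    PowerSeries.mk (bTransform u v x)
      = (PowerSeries.C u + PowerSeries.C v * PowerSeries.X) * PowerSeries.mk x := by
  ext n; simp [bTransform]

theorem transform_eq_sum (r s t : ℕ → 𝕜) (u v : 𝕜) (x : ℕ → 𝕜) (n : ℕ) :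
    transform r s t u v x n
      = 1 / r n * ∑ k ∈ Finset.range (n + 1), t k * bTransform u v x k * s (n - k) := by
  have h1 : ∑ k ∈ Finset.range (n + 1), t k * bTransform u v x k * s (n - k)
      = ∑ k ∈ Finset.range (n + 1), s (n - k) * t k * u * x k
        + ∑ k ∈ Finset.range n, s (n - k - 1) * t (k + 1) * v * x k := by
    rw [Finset.sum_range_succ', Finset.sum_range_succ' _ n, add_right_comm,
      ← Finset.sum_add_distrib, bTransform_zero]
    congr 1
    · refine Finset.sum_congr rfl fun k _ => ?_
      rw [bTransform_succ, Nat.sub_sub]; ring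
    · ring
  rw [transform, h1, Finset.sum_range_succ]
  simp only [add_mul, Finset.sum_add_distrib, Nat.sub_self]
  ring

/-- Clearing r_n leaves a Cauchy product, so that inverting the transform becomes algebra of power
series. -/
theorem transform_eq_iff {r : ℕ → 𝕜} (hr : ∀ n, r n ≠ 0) (s t : ℕ → 𝕜) (u v : 𝕜) (x y : ℕ → 𝕜) :
    transform r s t u v x = y ↔
      PowerSeries.mk (fun n => t n * bTransform u v x n) * PowerSeries.mk s
        = PowerSeries.mk fun n => r n * y n := by
  rw [funext_iff, PowerSeries.ext_iff]
  refine forall_congr' fun n => ?_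
  rw [PowerSeries.coeff_mul, Finset.Nat.sum_antidiagonal_eq_sum_range_succ
    (fun a b => PowerSeries.coeff a (PowerSeries.mk fun n => t n * bTransform u v x n)
      * PowerSeries.coeff b (PowerSeries.mk s)), transform_eq_sum]
  simp only [PowerSeries.coeff_mk]
  rw [one_div, inv_mul_eq_iff_eq_mul₀ (hr n)]

/-- The transform is onto. -/
theorem exists_transform_eq {r s t : ℕ → 𝕜} {u : 𝕜} (v : 𝕜) (hr : ∀ n, r n ≠ 0)
    (ht : ∀ n, t n ≠ 0) (hs : s 0 ≠ 0) (hu : u ≠ 0) (y : ℕ → 𝕜) :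
    ∃ x, transform r s t u v x = y := by
  -- The factors are undone from the outside in: r, then s, then t, then u + vX.
  set w : PowerSeries 𝕜 := PowerSeries.mk (fun n => r n * y n) *
    PowerSeries.mk (fun n => (-1) ^ n * coeffD s n) with hw
  set X : PowerSeries 𝕜 := PowerSeries.mk (fun n => (-v) ^ n / u ^ (n + 1)) *
    PowerSeries.mk (fun n => PowerSeries.coeff n w / t n) with hX
  refine ⟨fun n => PowerSeries.coeff n X, (transform_eq_iff hr _ _ _ _ _ _).2 ?_⟩
  have h1 : PowerSeries.mk (bTransform u v fun n => PowerSeries.coeff n X)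
      = PowerSeries.mk fun n => PowerSeries.coeff n w / t n := by
    rw [mk_bTransform]
    have : (PowerSeries.mk fun n => PowerSeries.coeff n X) = X := by ext; simp
    rw [this, hX, ← mul_assoc, mul_comm (_ + _), mk_geom_mul v hu, one_mul]
  have h2 : (PowerSeries.mk fun n => t n * bTransform u v (fun n => PowerSeries.coeff n X) n)
      = w := by
    ext n
    have := congrArg (PowerSeries.coeff n) h1
    simp only [PowerSeries.coeff_mk] at this ⊢
    rw [this, mul_div_cancel₀ _ (ht n)]
  rw [h2, hw, mul_assoc, mk_coeffD_mul hs, mul_one]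

/-- The terms `a_n x_n`, computed from the transform of `x` by the triangle `c_{nk}(a)`. -/
theorem mul_eq_sum_dualEntry {r s t : ℕ → 𝕜} {u : 𝕜} (v : 𝕜) (hr : ∀ n, r n ≠ 0)
    (ht : ∀ n, t n ≠ 0) (hs : s 0 ≠ 0) (hu : u ≠ 0) (a x : ℕ → 𝕜) (n : ℕ) :
    a n * x n
      = ∑ k ∈ Finset.range (n + 1), dualEntry r s t u v a n k * transform r s t u v x k := by
  set y := transform r s t u v x with hy
  have h1 := (transform_eq_iff hr _ _ _ _ _ _).1 hy.symm
  have h2 : PowerSeries.mk (fun n => t n * bTransform u v x n)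
      = (PowerSeries.mk fun n => r n * y n) *
        PowerSeries.mk (fun n => (-1) ^ n * coeffD s n) := by
    rw [← h1, mul_assoc, mul_comm (PowerSeries.mk s), mk_coeffD_mul hs, mul_one]
  have h3 : ∀ j, bTransform u v x j
      = ∑ k ∈ Finset.range (j + 1), r k * y k * ((-1) ^ (j - k) * coeffD s (j - k)) / t j := by
    intro j
    have := congrArg (PowerSeries.coeff j) h2
    rw [PowerSeries.coeff_mul, Finset.Nat.sum_antidiagonal_eq_sum_range_succ
      (fun a b => PowerSeries.coeff a (PowerSeries.mk fun n => r n * y n)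
      * PowerSeries.coeff b (PowerSeries.mk fun n => (-1) ^ n * coeffD s n))] at this
    simp only [PowerSeries.coeff_mk] at this
    rw [← Finset.sum_div, ← this, mul_div_cancel_left₀ _ (ht j)]
  have h4 : PowerSeries.mk x = PowerSeries.mk (bTransform u v x) *
      PowerSeries.mk (fun n => (-v) ^ n / u ^ (n + 1)) := by
    rw [mk_bTransform, mul_comm, ← mul_assoc, mk_geom_mul v hu, one_mul]
  have h5 := congrArg (PowerSeries.coeff n) h4
  rw [PowerSeries.coeff_mul, Finset.Nat.sum_antidiagonal_eq_sum_range_succ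
      (fun a b => PowerSeries.coeff a (PowerSeries.mk (bTransform u v x))
      * PowerSeries.coeff b (PowerSeries.mk fun n => (-v) ^ n / u ^ (n + 1)))] at h5
  simp only [PowerSeries.coeff_mk] at h5
  rw [h5]
  simp only [h3, dualEntry, Finset.sum_mul, Finset.mul_sum]
  rw [Finset.sum_comm' (t' := Finset.range (n + 1)) (s' := fun k => Finset.Icc k n)]
  · refine Finset.sum_congr rfl fun k _ => Finset.sum_congr rfl fun j _ => ?_
    ring
  · intro j k
    simp only [Finset.mem_range, Finset.mem_Icc]
    omega

theorem dualEntry_eq_zero (r s t : ℕ → 𝕜) (u v : 𝕜) (a : ℕ → 𝕜) {n k : ℕ} (h : n < k) :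
    dualEntry r s t u v a n k = 0 := by
  simp [dualEntry, Finset.Icc_eq_empty_of_lt h]

end Inversion

/-! ### Bounded multipliers -/

section Multipliers

variable {𝕜 : Type*} [RCLike 𝕜] {ι E : Type*} [AddCommGroup E] [Module 𝕜 E] {q : E → ℝ≥0∞}

/-- A point of the cube [0,1]^G is a convex combination of vertices, and q is convex. The induction
splits one coordinate at a time; the offset d absorbs the vectors already chosen. -/
theorem sum_smul_le_of_mem_Icc (hadd : ∀ x y, q (x + y) ≤ q x + q y)
    (hsmul : ∀ (a : 𝕜) x, q (a • x) = ‖a‖ₑ * q x) {b : ι → E} {M : ℝ≥0∞} {w : ι → ℝ}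
    (hw0 : ∀ k, 0 ≤ w k) (hw1 : ∀ k, w k ≤ 1) (G : Finset ι) (d : E)
    (h : ∀ F ⊆ G, q (d + ∑ k ∈ F, b k) ≤ M) :
    q (d + ∑ k ∈ G, (w k : 𝕜) • b k) ≤ M := by
  classical
  induction G using Finset.induction_on generalizing d with
  | empty => simpa using h ∅ (Finset.Subset.refl _)
  | insert k G hk ih =>
    have h1 := ih d fun F hF => h F (hF.trans (Finset.subset_insert _ _))
    have h2 := ih (d + b k) fun F hF => by
      have := h (insert k F) (Finset.insert_subset_insert _ hF)
      rwa [Finset.sum_insert fun hkF => hk (hF hkF), ← add_assoc] at this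
    set S := ∑ k ∈ G, (w k : 𝕜) • b k
    have hdec : d + ∑ k ∈ insert k G, (w k : 𝕜) • b k
        = ((1 - w k : ℝ) : 𝕜) • (d + S) + (w k : 𝕜) • (d + b k + S) := by
      rw [Finset.sum_insert hk]
      push_cast
      module
    have hen : ∀ x : ℝ, 0 ≤ x → ‖(x : 𝕜)‖ₑ = ENNReal.ofReal x := fun x hx => by
      rw [← ofReal_norm, RCLike.norm_ofReal, abs_of_nonneg hx]
    calc q (d + ∑ k ∈ insert k G, (w k : 𝕜) • b k)
        ≤ ENNReal.ofReal (1 - w k) * M + ENNReal.ofReal (w k) * M := by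
          rw [hdec]
          refine (hadd _ _).trans ?_
          rw [hsmul, hsmul, hen _ (hw0 k), hen _ (sub_nonneg.2 (hw1 k))]
          gcongr
      _ = M := by
          rw [← add_mul, ← ENNReal.ofReal_add (sub_nonneg.2 (hw1 k)) (hw0 k)]
          simp

/-- The constant 4 counts the positive and negative parts of the real and imaginary parts of w, each
a family in [0,1]. -/
theorem sum_smul_le (hadd : ∀ x y, q (x + y) ≤ q x + q y)
    (hsmul : ∀ (a : 𝕜) x, q (a • x) = ‖a‖ₑ * q x) {b : ι → E} {M : ℝ≥0∞}
    (h : ∀ F : Finset ι, q (∑ k ∈ F, b k) ≤ M) {w : ι → 𝕜} (hw : ∀ k, ‖w k‖ ≤ 1)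
    (G : Finset ι) : q (∑ k ∈ G, w k • b k) ≤ 4 * M := by
  have key : ∀ f : ι → ℝ, (∀ k, 0 ≤ f k) → (∀ k, f k ≤ 1) →
      q (∑ k ∈ G, (f k : 𝕜) • b k) ≤ M := fun f h0 h1 => by
    simpa using sum_smul_le_of_mem_Icc hadd hsmul h0 h1 G 0 fun F _ => by simpa using h F
  have hI : ‖(RCLike.I : 𝕜)‖ ≤ 1 := by
    rcases RCLike.I_eq_zero_or_im_I_eq_one (K := 𝕜) with h0 | h0
    · simp [h0]
    · exact (RCLike.norm_I_of_ne_zero fun h1 => by simp [h1] at h0).le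
  have part : ∀ (a : 𝕜) (f : ι → ℝ), ‖a‖ ≤ 1 → (∀ k, f k ≤ 1) →
      q (a • ∑ k ∈ G, ((max (f k) 0 : ℝ) : 𝕜) • b k) ≤ M := fun a f ha hf => by
    rw [hsmul]
    have ha' : ‖a‖ₑ ≤ 1 := by
      rw [← ofReal_norm]; exact ENNReal.ofReal_le_one.2 ha
    calc _ ≤ 1 * M := mul_le_mul' ha' (key _ (fun k => le_max_right _ _)
            fun k => max_le (hf k) zero_le_one)
      _ = M := one_mul M
  have hdec : ∑ k ∈ G, w k • b k
      = (1 : 𝕜) • ∑ k ∈ G, ((max (RCLike.re (w k)) 0 : ℝ) : 𝕜) • b k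
        + (-1 : 𝕜) • ∑ k ∈ G, ((max (-RCLike.re (w k)) 0 : ℝ) : 𝕜) • b k
        + (RCLike.I : 𝕜) • ∑ k ∈ G, ((max (RCLike.im (w k)) 0 : ℝ) : 𝕜) • b k
        + (-RCLike.I : 𝕜) • ∑ k ∈ G, ((max (-RCLike.im (w k)) 0 : ℝ) : 𝕜) • b k := by
    simp only [Finset.smul_sum, ← Finset.sum_add_distrib]
    refine Finset.sum_congr rfl fun k _ => ?_
    conv_lhs => rw [← RCLike.re_add_im (w k), ← max_zero_sub_max_neg_zero_eq_self (RCLike.re (w k)),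
      ← max_zero_sub_max_neg_zero_eq_self (RCLike.im (w k)), RCLike.ofReal_sub, RCLike.ofReal_sub]
    module
  have hre : ∀ k, |RCLike.re (w k)| ≤ 1 := fun k => (RCLike.abs_re_le_norm _).trans (hw k)
  have him : ∀ k, |RCLike.im (w k)| ≤ 1 := fun k => (RCLike.abs_im_le_norm _).trans (hw k)
  rw [hdec]
  calc _ ≤ M + M + M + M := by
        refine (hadd _ _).trans (add_le_add ((hadd _ _).trans (add_le_add
          ((hadd _ _).trans (add_le_add ?_ ?_)) ?_)) ?_)
        · exact part _ _ (by simp) fun k => (abs_le.1 (hre k)).2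
        · exact part _ _ (by simp) fun k => neg_le.1 (abs_le.1 (hre k)).1
        · exact part _ _ hI fun k => (abs_le.1 (him k)).2
        · exact part _ _ (by simpa using hI) fun k => neg_le.1 (abs_le.1 (him k)).1
    _ = 4 * M := by ring

theorem sum_smul_le_of_norm_le (hadd : ∀ x y, q (x + y) ≤ q x + q y)
    (hsmul : ∀ (a : 𝕜) x, q (a • x) = ‖a‖ₑ * q x) {b : ι → E} {M : ℝ≥0∞} {l : ι → ℝ}
    (hl : ∀ k, 0 < l k) (h : ∀ F : Finset ι, q (∑ k ∈ F, (l k : 𝕜) • b k) ≤ M) {y : ι → 𝕜}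
    {B : ℝ} (hB : 0 < B) (hy : ∀ k, ‖y k‖ ≤ B * l k) (G : Finset ι) :
    q (∑ k ∈ G, y k • b k) ≤ ENNReal.ofReal B * (4 * M) := by
  have h1 : ∑ k ∈ G, y k • b k
      = (B : 𝕜) • ∑ k ∈ G, (y k / ((B * l k : ℝ) : 𝕜)) • (l k : 𝕜) • b k := by
    rw [Finset.smul_sum]
    refine Finset.sum_congr rfl fun k _ => ?_
    rw [smul_smul, smul_smul]
    congr 1
    have h1 : (B : 𝕜) ≠ 0 := by exact_mod_cast hB.ne'
    have h2 : (l k : 𝕜) ≠ 0 := by exact_mod_cast (hl k).ne'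
    push_cast
    field_simp
  rw [h1, hsmul, ← ofReal_norm, RCLike.norm_ofReal, abs_of_pos hB]
  gcongr
  refine sum_smul_le hadd hsmul h (fun k => ?_) G
  rw [norm_div, RCLike.norm_ofReal, abs_of_pos (mul_pos hB (hl k))]
  exact div_le_one_of_le₀ (hy k) (mul_pos hB (hl k)).le

end Multipliers

/-! ### The norm of `l₁` -/

section EllOne

variable {𝕜 : Type*} [RCLike 𝕜]

/-- The `l₁`-norm of a sequence, with values in `[0, ∞]`. -/
noncomputable def lnorm (x : ℕ → 𝕜) : ℝ≥0∞ := ∑' n, ‖x n‖ₑ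

theorem mem_ellOne_iff {x : ℕ → 𝕜} : x ∈ ellOne 𝕜 ↔ lnorm x ≠ ∞ := by
  simp only [ellOne, Set.mem_ofPred_eq, lnorm, enorm_eq_nnnorm]
  rw [ENNReal.tsum_coe_ne_top_iff_summable, ← NNReal.summable_coe]
  simp

@[simp]
theorem lnorm_zero : lnorm (0 : ℕ → 𝕜) = 0 := by simp [lnorm]

theorem lnorm_add_le (x y : ℕ → 𝕜) : lnorm (x + y) ≤ lnorm x + lnorm y := by
  rw [lnorm, lnorm, lnorm, ← ENNReal.tsum_add]
  exact ENNReal.tsum_le_tsum fun n => enorm_add_le _ _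

theorem lnorm_smul (a : 𝕜) (x : ℕ → 𝕜) : lnorm (a • x) = ‖a‖ₑ * lnorm x := by
  simp [lnorm, ENNReal.tsum_mul_left]

theorem lnorm_sum_le {ι : Type*} (F : Finset ι) (x : ι → ℕ → 𝕜) :
    lnorm (∑ k ∈ F, x k) ≤ ∑ k ∈ F, lnorm (x k) :=
  Finset.le_sum_of_subadditive _ lnorm_zero.le lnorm_add_le _ _

theorem enorm_sum_le_lnorm (x : ℕ → 𝕜) (F : Finset ℕ) : ‖∑ n ∈ F, x n‖ₑ ≤ lnorm x :=
  (enorm_sum_le _ _).trans (ENNReal.sum_le_tsum _)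

/-- A sequence with bounded finite subsums is absolutely summable. -/
theorem lnorm_le_of_forall_enorm_sum_le {x : ℕ → 𝕜} {M : ℝ≥0∞}
    (h : ∀ F : Finset ℕ, ‖∑ n ∈ F, x n‖ₑ ≤ M) : lnorm x ≤ 4 * M := by
  rw [lnorm, ENNReal.tsum_eq_iSup_sum]
  refine iSup_le fun G => ?_
  -- The weights rotate each x_n to |x_n|; where x_n = 0, division by zero makes the weight 0.
  have hw : ∀ n, ‖star (x n) / (‖x n‖ : 𝕜)‖ ≤ 1 := fun n => by
    rw [norm_div, norm_star, RCLike.norm_ofReal, abs_norm]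
    exact div_self_le_one _
  have h1 := sum_smul_le (𝕜 := 𝕜) (q := fun z : 𝕜 => ‖z‖ₑ) (fun x y => enorm_add_le x y)
    (fun a x => enorm_smul a x) h hw G
  have h2 : ∑ n ∈ G, (star (x n) / (‖x n‖ : 𝕜)) • x n = ((∑ n ∈ G, ‖x n‖ : ℝ) : 𝕜) := by
    rw [RCLike.ofReal_sum]
    refine Finset.sum_congr rfl fun n _ => ?_
    rcases eq_or_ne (x n) 0 with h0 | h0
    · simp [h0]
    · have : (‖x n‖ : 𝕜) ≠ 0 := by simpa using h0
      rw [smul_eq_mul, div_mul_eq_mul_div, div_eq_iff this, RCLike.star_def, RCLike.conj_mul, sq]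
  simp only [h2] at h1
  rw [← ofReal_norm, RCLike.norm_ofReal,
    abs_of_nonneg (Finset.sum_nonneg fun _ _ => norm_nonneg _),
    ENNReal.ofReal_sum_of_nonneg fun _ _ => norm_nonneg _] at h1
  simpa [ofReal_norm] using h1

end EllOne

/-! ### Transforms by triangles -/

section Triangle

variable {𝕜 : Type*} [RCLike 𝕜]

/-- The transform of `y` by the triangle `c`. -/
def triApply (c : ℕ → ℕ → 𝕜) (y : ℕ → 𝕜) (n : ℕ) : 𝕜 :=
  ∑ k ∈ Finset.range (n + 1), c n k * y k

/-- The `k`-th column of `c`. -/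
def column (c : ℕ → ℕ → 𝕜) (k n : ℕ) : 𝕜 := c n k

theorem triApply_add (c : ℕ → ℕ → 𝕜) (y z : ℕ → 𝕜) :
    triApply c (y + z) = triApply c y + triApply c z := by
  funext n; simp [triApply, mul_add, Finset.sum_add_distrib]

theorem triApply_smul (c : ℕ → ℕ → 𝕜) (a : 𝕜) (y : ℕ → 𝕜) :
    triApply c (a • y) = a • triApply c y := by
  funext n; simp [triApply, Finset.mul_sum, mul_left_comm]

theorem triApply_congr (c : ℕ → ℕ → 𝕜) {y z : ℕ → 𝕜} {n : ℕ} (h : ∀ k ≤ n, y k = z k) :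
    triApply c y n = triApply c z n :=
  Finset.sum_congr rfl fun k hk => by rw [h k (Nat.lt_succ_iff.1 (Finset.mem_range.1 hk))]

variable {c : ℕ → ℕ → 𝕜}

theorem triApply_eq_sum_column (hc : ∀ n k, n < k → c n k = 0) {y : ℕ → 𝕜} {F : Finset ℕ}
    (hy : ∀ k ∉ F, y k = 0) : triApply c y = ∑ k ∈ F, y k • column c k := by
  funext n
  rw [Finset.sum_apply, triApply]
  simp only [Pi.smul_apply, smul_eq_mul, column, mul_comm (y _)]
  have h1 : ∑ k ∈ F, c n k * y k = ∑ k ∈ F ∪ Finset.range (n + 1), c n k * y k :=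
    Finset.sum_subset Finset.subset_union_left fun k _ hk => by rw [hy k hk, mul_zero]
  rw [h1]
  refine Finset.sum_subset Finset.subset_union_right fun k _ hk => ?_
  rw [hc n k (by simpa using hk), zero_mul]

/-- The first N rows see only the first N entries of y, so truncating y does not change them. -/
theorem lnorm_triApply_le (hc : ∀ n k, n < k → c n k = 0) {y : ℕ → 𝕜} {M : ℝ≥0∞}
    (h : ∀ N, lnorm (∑ k ∈ Finset.range N, y k • column c k) ≤ M) :
    lnorm (triApply c y) ≤ M := by
  refine ENNReal.tsum_le_of_sum_range_le fun N => ?_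
  refine le_trans ?_ (h N)
  refine le_trans (Finset.sum_le_sum fun n hn => ?_) (ENNReal.sum_le_tsum (Finset.range N))
  set z : ℕ → 𝕜 := fun k => if k < N then y k else 0
  have h1 : ∑ k ∈ Finset.range N, y k • column c k = triApply c z := by
    rw [triApply_eq_sum_column hc (F := Finset.range N) (y := z)
      fun k hk => if_neg (by simpa using hk)]
    refine Finset.sum_congr rfl fun k hk => ?_
    simp [z, Finset.mem_range.1 hk]
  rw [h1, triApply_congr c (z := z)]
  intro k hk
  have : k < N := hk.trans_lt (Finset.mem_range.1 hn)
  simp [z, this]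

theorem triApply_single (hc : ∀ n k, n < k → c n k = 0) (k : ℕ) (a : 𝕜) :
    triApply c (Pi.single k a) = a • column c k := by
  rw [triApply_eq_sum_column hc (F := {k})]
  · simp
  · intro i hi
    exact Pi.single_eq_of_ne (by simpa using hi) _

theorem lnorm_sum_smul_column_ne_top (hcol : ∀ k, lnorm (column c k) ≠ ∞) (y : ℕ → 𝕜)
    (F : Finset ℕ) : lnorm (∑ k ∈ F, y k • column c k) ≠ ∞ := by
  refine ne_top_of_le_ne_top ?_ (lnorm_sum_le F _)
  refine (ENNReal.sum_lt_top.2 fun k _ => ?_).ne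
  rw [lnorm_smul]
  exact ENNReal.mul_lt_top enorm_lt_top (hcol k).lt_top

/-- The new hump z starts past the support of y, and its image exceeds the finite norm of the image
of y by more than j. The reverse triangle inequality then leaves at least j for y + z, already
within finitely many rows. -/
theorem exists_gliding_step (hc : ∀ n k, n < k → c n k = 0)
    (hcol : ∀ k, lnorm (column c k) ≠ ∞) {P : ℕ → (ℕ → 𝕜) → Prop}
    (h : ∀ j N (M : ℝ≥0∞), M ≠ ∞ → ∃ (z : ℕ → 𝕜) (N' : ℕ), P j z ∧ (∀ k < N, z k = 0) ∧
      (∀ k, N' ≤ k → z k = 0) ∧ M < lnorm (triApply c z))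
    (j m : ℕ) {y : ℕ → 𝕜} (hy : ∀ k, m ≤ k → y k = 0) :
    ∃ (m' : ℕ) (y' : ℕ → 𝕜), (∀ k, m' ≤ k → y' k = 0) ∧ m < m' ∧ (∀ k < m, y' k = y k) ∧
      P j (fun k => if m ≤ k then y' k else 0) ∧
      (j : ℝ≥0∞) ≤ ∑ n ∈ Finset.range m', ‖triApply c y' n‖ₑ := by
  have hfin : lnorm (triApply c y) ≠ ∞ := by
    rw [triApply_eq_sum_column hc (F := Finset.range m) fun k hk => hy k (by simpa using hk)]
    exact lnorm_sum_smul_column_ne_top hcol _ _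
  obtain ⟨z, N', hP, hz, hz', hM⟩ := h j m (lnorm (triApply c y) + j) (by simp [hfin])
  rw [show lnorm (triApply c z) = _ from ENNReal.tsum_eq_iSup_nat, lt_iSup_iff] at hM
  obtain ⟨N'', hM⟩ := hM
  refine ⟨max (m + 1) (max N' N''), y + z, fun k hk => ?_, by omega, fun k hk => ?_, ?_, ?_⟩
  · rw [Pi.add_apply, hy k (by omega), hz' k (by omega), add_zero]
  · rw [Pi.add_apply, hz k hk, add_zero]
  · convert hP using 1
    funext k
    split_ifs with hk
    · rw [Pi.add_apply, hy k hk, zero_add]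
    · rw [hz k (by omega)]
  · set K := max (m + 1) (max N' N'')
    have h1 : ∑ n ∈ Finset.range N'', ‖triApply c z n‖ₑ
        ≤ lnorm (triApply c y) + ∑ n ∈ Finset.range K, ‖triApply c (y + z) n‖ₑ := by
      calc ∑ n ∈ Finset.range N'', ‖triApply c z n‖ₑ
          ≤ ∑ n ∈ Finset.range K, ‖triApply c z n‖ₑ :=
            Finset.sum_le_sum_of_subset (Finset.range_mono (by omega))
        _ ≤ ∑ n ∈ Finset.range K, (‖triApply c y n‖ₑ + ‖triApply c (y + z) n‖ₑ) := by
            refine Finset.sum_le_sum fun n _ => ?_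
            have : triApply c z n = triApply c (y + z) n - triApply c y n := by
              rw [triApply_add]; simp
            rw [this]
            exact enorm_sub_le.trans (add_comm _ _).le
        _ ≤ _ := by
            rw [Finset.sum_add_distrib]
            gcongr
            exact ENNReal.sum_le_tsum _
    exact (ENNReal.add_le_add_iff_left hfin).1 (hM.le.trans h1)

/-- The gliding hump for triangles: blocks of large norm, found arbitrarily far out, can be
assembled into a sequence whose transform is not absolutely summable. -/
theorem exists_gliding_hump (hc : ∀ n k, n < k → c n k = 0)
    (hcol : ∀ k, lnorm (column c k) ≠ ∞) {P : ℕ → (ℕ → 𝕜) → Prop}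
    (h : ∀ j N (M : ℝ≥0∞), M ≠ ∞ → ∃ (z : ℕ → 𝕜) (N' : ℕ), P j z ∧ (∀ k < N, z k = 0) ∧
      (∀ k, N' ≤ k → z k = 0) ∧ M < lnorm (triApply c z)) :
    ∃ (y : ℕ → 𝕜) (m : ℕ → ℕ), StrictMono m ∧ m 0 = 0 ∧
      (∀ j, P j (fun k => if m j ≤ k ∧ k < m (j + 1) then y k else 0)) ∧
      lnorm (triApply c y) = ∞ := by
  -- A state is a cut point with a sequence vanishing from there on.
  let σ := {s : ℕ × (ℕ → 𝕜) // ∀ k, s.1 ≤ k → s.2 k = 0}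
  have hstep : ∀ (j : ℕ) (s : σ), ∃ s' : σ, s.1.1 < s'.1.1 ∧ (∀ k < s.1.1, s'.1.2 k = s.1.2 k) ∧
      P j (fun k => if s.1.1 ≤ k then s'.1.2 k else 0) ∧
      (j : ℝ≥0∞) ≤ ∑ n ∈ Finset.range s'.1.1, ‖triApply c s'.1.2 n‖ₑ := by
    intro j s
    obtain ⟨m', y', h0, h1⟩ := exists_gliding_step hc hcol h j s.1.1 s.2
    exact ⟨⟨(m', y'), h0⟩, h1⟩
  choose f hf using hstep
  let S : ℕ → σ := fun n => Nat.rec ⟨(0, 0), fun _ _ => rfl⟩ (fun j s => f j s) n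
  have hS : ∀ j, S (j + 1) = f j (S j) := fun j => rfl
  have hmono : StrictMono fun j => (S j).1.1 := strictMono_nat_of_lt_succ fun j => (hf j (S j)).1
  have hstab : ∀ i j, i ≤ j → ∀ k < (S i).1.1, (S j).1.2 k = (S i).1.2 k := by
    intro i j hij
    induction j, hij using Nat.le_induction with
    | base => exact fun _ _ => rfl
    | succ j hij ih =>
      intro k hk
      rw [hS, (hf j (S j)).2.1 k (hk.trans_le (hmono.monotone hij)), ih k hk]
  -- Entry k may be read off at stage k + 1, because the cut points increase strictly and so the one
  -- at stage k + 1 exceeds k.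
  have hy : ∀ j, ∀ k < (S j).1.1, (S (k + 1)).1.2 k = (S j).1.2 k := by
    intro j k hk
    have hk' : k < (S (k + 1)).1.1 := Nat.lt_of_succ_le (hmono.le_apply)
    rcases le_total (k + 1) j with hkj | hkj
    · exact (hstab _ _ hkj k hk').symm
    · exact hstab _ _ hkj k hk
  refine ⟨fun k => (S (k + 1)).1.2 k, fun j => (S j).1.1, hmono, rfl, fun j => ?_, ?_⟩
  · convert (hf j (S j)).2.2.1 using 1
    funext k
    rw [← hS]
    by_cases h1 : (S j).1.1 ≤ k
    · by_cases h2 : k < (S (j + 1)).1.1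
      · simp [h1, h2, hy (j + 1) k h2]
      · simp [h1, h2, (S (j + 1)).2 k (not_lt.1 h2)]
    · simp [h1]
  · refine ENNReal.eq_top_of_forall_nnreal_le fun a => ?_
    obtain ⟨j, hj⟩ := exists_nat_ge a
    calc (a : ℝ≥0∞) ≤ j := by exact_mod_cast hj
      _ ≤ _ := (hf j (S j)).2.2.2
      _ = ∑ n ∈ Finset.range (S (j + 1)).1.1,
            ‖triApply c (fun k => (S (k + 1)).1.2 k) n‖ₑ := by
          refine Finset.sum_congr rfl fun n hn => ?_
          rw [← hS]
          congr 1
          refine triApply_congr c fun k hk => (hy (j + 1) k ?_).symm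
          exact hk.trans_lt (Finset.mem_range.1 hn)
      _ ≤ _ := ENNReal.sum_le_tsum _

end Triangle

/-! ### Triangles from the sequence spaces of Maddox into `l₁` -/

section Maddox

variable {𝕜 : Type*} [RCLike 𝕜] {p : ℕ → ℝ}

theorem maddoxL_subset_maddoxC0 (p : ℕ → ℝ) : maddoxL 𝕜 p ⊆ maddoxC0 𝕜 p :=
  fun _ hx => Summable.tendsto_atTop_zero hx

theorem maddoxC0_subset_maddoxC (p : ℕ → ℝ) : maddoxC0 𝕜 p ⊆ maddoxC 𝕜 p :=
  fun x hx => ⟨0, by simpa using show Tendsto (fun k => ‖x k‖ ^ p k) atTop (𝓝 0) from hx⟩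

theorem maddoxC0_subset_maddoxLInf (p : ℕ → ℝ) : maddoxC0 𝕜 p ⊆ maddoxLInf 𝕜 p :=
  fun _ hx => Tendsto.bddAbove_range hx

theorem single_mem_maddoxL (hp : ∀ k, 0 < p k) (k : ℕ) (a : 𝕜) :
    Pi.single k a ∈ maddoxL 𝕜 p := by
  refine summable_of_ne_finset_zero (s := {k}) fun i hi => ?_
  rw [Pi.single_eq_of_ne (by simpa using hi), norm_zero, Real.zero_rpow (hp i).ne']

theorem exists_mem_Ico_of_strictMono {m : ℕ → ℕ} (hm : StrictMono m) {j₀ k : ℕ} (h : m j₀ ≤ k) :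
    ∃ j, j₀ ≤ j ∧ m j ≤ k ∧ k < m (j + 1) := by
  have hex : ∃ i, k < m i := ⟨k + 1, Nat.lt_of_succ_le hm.le_apply⟩
  classical
  have h1 := Nat.find_spec hex
  have h2 : j₀ < Nat.find hex := hm.lt_iff_lt.1 (h.trans_lt h1)
  obtain ⟨j, hj⟩ : ∃ j, Nat.find hex = j + 1 := ⟨Nat.find hex - 1, by omega⟩
  refine ⟨j, by omega, not_lt.1 (Nat.find_min hex (by omega)), hj ▸ h1⟩

theorem iSup_nonempty_lt_top_iff {ι : Type*} {f : Finset ι → ℝ≥0∞} :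
    (⨆ (F : Finset ι) (_ : F.Nonempty), f F) < ∞ ↔
      ∃ M : ℝ≥0∞, M ≠ ∞ ∧ ∀ F : Finset ι, F.Nonempty → f F ≤ M :=
  ⟨fun h => ⟨_, h.ne, fun F hF => le_iSup₂ (f := fun (F : Finset ι) (_ : F.Nonempty) => f F) F hF⟩,
    fun ⟨_, hM, h⟩ => (iSup₂_le h).trans_lt hM.lt_top⟩

variable {c : ℕ → ℕ → 𝕜}

theorem iSup_tsum_enorm_lt_top_iff {l : ℕ → ℝ} :
    (⨆ (F : Finset ℕ) (_ : F.Nonempty), ∑' n, ‖∑ k ∈ F, c n k * ((l k : ℝ) : 𝕜)‖ₑ) < ∞ ↔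
      ∃ M : ℝ≥0∞, M ≠ ∞ ∧ ∀ F : Finset ℕ, lnorm (∑ k ∈ F, (l k : 𝕜) • column c k) ≤ M := by
  have h : ∀ F : Finset ℕ, lnorm (∑ k ∈ F, (l k : 𝕜) • column c k)
      = ∑' n, ‖∑ k ∈ F, c n k * ((l k : ℝ) : 𝕜)‖ₑ := fun F => by
    simp only [lnorm, column, Finset.sum_apply, Pi.smul_apply, smul_eq_mul, mul_comm]
  rw [iSup_nonempty_lt_top_iff]
  simp only [h]
  refine exists_congr fun M => and_congr_right fun _ => ⟨fun h F => ?_, fun h F _ => h F⟩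
  rcases F.eq_empty_or_nonempty with rfl | hF
  · simp
  · exact h F hF

/-- Column k is the image of the k-th unit vector. -/
theorem column_ne_top (hc : ∀ n k, n < k → c n k = 0) (hp : ∀ k, 0 < p k)
    (h : ∀ y ∈ maddoxL 𝕜 p, triApply c y ∈ ellOne 𝕜) (k : ℕ) : lnorm (column c k) ≠ ∞ := by
  have := mem_ellOne_iff.1 (h _ (single_mem_maddoxL hp k 1))
  rwa [triApply_single hc, one_smul] at this

/-- Dropping the indices below N from a finite set F changes the norm of its sum by at most the
finite number B, so unbounded sums over F remain unbounded beyond N. -/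
theorem exists_gliding_hump_weights (hc : ∀ n k, n < k → c n k = 0)
    (hcol : ∀ k, lnorm (column c k) ≠ ∞) {l : ℕ → ℕ → ℝ}
    (h : ∀ j, ¬ ∃ M : ℝ≥0∞, M ≠ ∞ ∧
      ∀ F : Finset ℕ, lnorm (∑ k ∈ F, (l j k : 𝕜) • column c k) ≤ M) :
    ∃ (y : ℕ → 𝕜) (m : ℕ → ℕ), StrictMono m ∧ m 0 = 0 ∧
      (∀ j k, m j ≤ k → k < m (j + 1) → ‖y k‖ ≤ |l j k|) ∧ lnorm (triApply c y) = ∞ := by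
  obtain ⟨y, m, hm, hm0, hP, hy⟩ := exists_gliding_hump hc hcol
    (P := fun j z => ∀ k, ‖z k‖ ≤ |l j k|) fun j N M hM => by
      set B := ∑ k ∈ Finset.range N, lnorm ((l j k : 𝕜) • column c k)
      have hB : B ≠ ∞ := by
        refine (ENNReal.sum_lt_top.2 fun k _ => ?_).ne
        rw [lnorm_smul]
        exact ENNReal.mul_lt_top enorm_lt_top (hcol k).lt_top
      have := h j
      push Not at this
      obtain ⟨F, hF⟩ := this (B + M) (by simp [hB, hM])
      set G := F.filter fun k => N ≤ k
      set z : ℕ → 𝕜 := fun k => if k ∈ G then (l j k : 𝕜) else 0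
      have hz : triApply c z = ∑ k ∈ G, (l j k : 𝕜) • column c k := by
        rw [triApply_eq_sum_column hc (F := G) fun k hk => if_neg hk]
        exact Finset.sum_congr rfl fun k hk => by simp [hk]
      refine ⟨z, F.sup id + 1, fun k => ?_, fun k hk => ?_, fun k hk => ?_, ?_⟩
      · by_cases hk : k ∈ G <;> simp [z, hk]
      · exact if_neg fun h' => by simp [G] at h'; omega
      · refine if_neg fun h' => ?_
        have := Finset.le_sup (f := id) (Finset.mem_filter.1 h').1
        simp only [id] at this
        omega
      · rw [hz]
        refine (ENNReal.add_lt_add_iff_left hB).1 (hF.trans_le ?_)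
        rw [← Finset.sum_filter_not_add_sum_filter F (fun k => N ≤ k)]
        refine (lnorm_add_le _ _).trans (add_le_add_left ((lnorm_sum_le _ _).trans
          (Finset.sum_le_sum_of_subset fun k hk => ?_)) _)
        simp at hk ⊢
        omega
  refine ⟨y, m, hm, hm0, fun j k h1 h2 => ?_, hy⟩
  simpa [h1, h2] using hP j k

/-- The finitely many indices that violate the bound are absorbed into a constant factor, since
every l k is positive. -/
theorem triApply_mem_ellOne_of_bounded (hc : ∀ n k, n < k → c n k = 0) {l : ℕ → ℝ}
    (hl : ∀ k, 0 < l k)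
    (h : ∃ M : ℝ≥0∞, M ≠ ∞ ∧ ∀ F : Finset ℕ, lnorm (∑ k ∈ F, (l k : 𝕜) • column c k) ≤ M)
    {y : ℕ → 𝕜} (hy : ∀ᶠ k in atTop, ‖y k‖ ≤ l k) : triApply c y ∈ ellOne 𝕜 := by
  obtain ⟨M, hM, h⟩ := h
  have h1 : ∀ᶠ k in atTop, ‖y k‖ / l k ≤ 1 :=
    hy.mono fun k hk => div_le_one_of_le₀ hk (hl k).le
  obtain ⟨B, hB⟩ := (isBoundedUnder_of_eventually_le h1).bddAbove_range
  have hB' : ∀ k, ‖y k‖ ≤ max B 1 * l k := fun k =>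
    (div_le_iff₀ (hl k)).1 ((hB ⟨k, rfl⟩).trans (le_max_left _ _))
  rw [mem_ellOne_iff]
  refine ne_top_of_le_ne_top ?_ (lnorm_triApply_le hc fun N =>
    sum_smul_le_of_norm_le lnorm_add_le lnorm_smul hl h (lt_max_of_lt_right one_pos) hB'
      (Finset.range N))
  exact ENNReal.mul_ne_top ENNReal.ofReal_ne_top (ENNReal.mul_ne_top (by simp) hM)

/-- The link is |y_k| ≤ L^{-1/p_k} ⇔ |y_k|^{p_k} ≤ 1/L. If every L fails, using L = j + 1 on the
j-th block forces |y_k|^{p_k} → 0. -/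
theorem maddoxC0_maps_iff (hc : ∀ n k, n < k → c n k = 0) (hp : ∀ k, 0 < p k) :
    (∀ y ∈ maddoxC0 𝕜 p, triApply c y ∈ ellOne 𝕜) ↔ ∃ L : ℕ, 1 ≤ L ∧
      (⨆ (F : Finset ℕ) (_ : F.Nonempty), ∑' n,
        ‖∑ k ∈ F, c n k * (((L : ℝ) ^ (-1 / p k) : ℝ) : 𝕜)‖ₑ) < ∞ := by
  have hrw : ∀ (L : ℕ) k, (L : ℝ) ^ (-1 / p k) = ((L : ℝ)⁻¹) ^ (p k)⁻¹ := fun L k => by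
    rw [neg_div, one_div, Real.rpow_neg (Nat.cast_nonneg _), Real.inv_rpow (Nat.cast_nonneg _)]
  simp only [iSup_tsum_enorm_lt_top_iff]
  constructor
  · intro h
    by_contra! hH
    obtain ⟨y, m, hm, -, hy, htop⟩ := exists_gliding_hump_weights hc
      (column_ne_top hc hp fun y hy => h y (maddoxL_subset_maddoxC0 p hy))
      (l := fun j k => ((j + 1 : ℕ) : ℝ) ^ (-1 / p k))
      fun j ⟨M, hM, hMF⟩ => by
        obtain ⟨F, hF⟩ := hH (j + 1) (by omega) M hM
        exact hF.not_ge (hMF F)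
    refine mem_ellOne_iff.1 (h y ?_) htop
    refine tendsto_order.2 ⟨fun a ha => .of_forall fun k => ha.trans_le (by positivity),
      fun ε hε => ?_⟩
    obtain ⟨j₀, hj₀⟩ := exists_nat_one_div_lt hε
    filter_upwards [eventually_ge_atTop (m j₀)] with k hk
    obtain ⟨j, hj, h1, h2⟩ := exists_mem_Ico_of_strictMono hm hk
    have h3 := hy j k h1 h2
    rw [abs_of_nonneg (by positivity), hrw,
      Real.le_rpow_inv_iff_of_pos (norm_nonneg _) (by positivity) (hp k)] at h3
    refine h3.trans_lt (lt_of_le_of_lt ?_ hj₀)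
    rw [one_div]
    push_cast
    gcongr
  · rintro ⟨L, hL, h⟩ y hy
    have hL0 : (0 : ℝ) < (L : ℝ)⁻¹ := by positivity
    refine triApply_mem_ellOne_of_bounded hc (fun k => by positivity) h ?_
    filter_upwards [(tendsto_order.1 hy).2 _ hL0] with k hk
    rw [hrw, Real.le_rpow_inv_iff_of_pos (norm_nonneg _) hL0.le (hp k)]
    exact hk.le

/-- Here a single failing L serves for all blocks, and |y_k|^{p_k} ≤ L throughout. -/
theorem maddoxLInf_maps_iff (hc : ∀ n k, n < k → c n k = 0) (hp : ∀ k, 0 < p k) :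
    (∀ y ∈ maddoxLInf 𝕜 p, triApply c y ∈ ellOne 𝕜) ↔ ∀ L : ℕ, 1 ≤ L →
      (⨆ (F : Finset ℕ) (_ : F.Nonempty), ∑' n,
        ‖∑ k ∈ F, c n k * (((L : ℝ) ^ (1 / p k) : ℝ) : 𝕜)‖ₑ) < ∞ := by
  simp only [iSup_tsum_enorm_lt_top_iff, one_div]
  constructor
  · intro h L hL
    by_contra hH
    obtain ⟨y, m, hm, hm0, hy, htop⟩ := exists_gliding_hump_weights hc
      (column_ne_top hc hp fun y hy =>
        h y (maddoxC0_subset_maddoxLInf p (maddoxL_subset_maddoxC0 p hy)))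
      (l := fun _ k => (L : ℝ) ^ (p k)⁻¹) fun _ => hH
    refine mem_ellOne_iff.1 (h y ⟨L, ?_⟩) htop
    rintro _ ⟨k, rfl⟩
    obtain ⟨j, -, h1, h2⟩ := exists_mem_Ico_of_strictMono hm (j₀ := 0) (hm0.le.trans k.zero_le)
    have := hy j k h1 h2
    rwa [abs_of_nonneg (by positivity),
      Real.le_rpow_inv_iff_of_pos (norm_nonneg _) (Nat.cast_nonneg _) (hp k)] at this
  · rintro h y ⟨K, hK⟩
    obtain ⟨L, hL⟩ := exists_nat_ge K
    have hL1 : (0 : ℝ) < (L + 1 : ℕ) := by positivity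
    refine triApply_mem_ellOne_of_bounded hc (fun k => by positivity) (h (L + 1) (by omega)) ?_
    refine .of_forall fun k => ?_
    rw [Real.le_rpow_inv_iff_of_pos (norm_nonneg _) hL1.le (hp k)]
    refine (hK ⟨k, rfl⟩).trans (hL.trans ?_)
    push_cast
    linarith

theorem maddoxC_maps_iff (hp : ∀ k, 0 < p k) :
    (∀ y ∈ maddoxC 𝕜 p, triApply c y ∈ ellOne 𝕜) ↔
      (∀ y ∈ maddoxC0 𝕜 p, triApply c y ∈ ellOne 𝕜) ∧
        (∑' n, ‖∑ k ∈ Finset.range (n + 1), c n k‖ₑ) < ∞ := by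
  have hone : (∑' n, ‖∑ k ∈ Finset.range (n + 1), c n k‖ₑ) = lnorm (triApply c 1) := by
    simp [lnorm, triApply]
  rw [hone, lt_top_iff_ne_top, ← mem_ellOne_iff]
  refine ⟨fun h => ⟨fun y hy => h y (maddoxC0_subset_maddoxC p hy), h 1 ⟨1, ?_⟩⟩, ?_⟩
  · simp [Real.zero_rpow (hp _).ne']
  · rintro ⟨h0, h1⟩ y ⟨a, ha⟩
    -- Subtracting the limit leaves an element of c₀(p); the constant part is a multiple of the row
    -- sums.
    have hy : y = (y - a • 1) + a • 1 := by simp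
    have h2 := h0 (y - a • 1) (by simpa [maddoxC0] using ha)
    rw [mem_ellOne_iff] at h1 h2 ⊢
    rw [hy, triApply_add, triApply_smul]
    refine ne_top_of_le_ne_top ?_ (lnorm_add_le _ _)
    rw [lnorm_smul]
    exact ENNReal.add_ne_top.2 ⟨h2, ENNReal.mul_ne_top enorm_ne_top h1⟩

end Maddox

/-! ### Triangles from l(p) into l₁ -/

section MaddoxL

variable {𝕜 : Type*} [RCLike 𝕜] {p : ℕ → ℝ} {c : ℕ → ℕ → 𝕜}

/-- A sequence made of blocks of rapidly decreasing size lies in `l(p)`. -/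
theorem mem_maddoxL_of_blocks {y : ℕ → 𝕜} {m : ℕ → ℕ} (hm : StrictMono m) (hm0 : m 0 = 0)
    (h : ∀ j, ∑ k ∈ Finset.Ico (m j) (m (j + 1)), ‖y k‖ ^ p k ≤ (1 / 2) ^ j) :
    y ∈ maddoxL 𝕜 p := by
  have h1 : ∀ J, ∑ k ∈ Finset.range (m J), ‖y k‖ ^ p k ≤ ∑ j ∈ Finset.range J, (1 / 2 : ℝ) ^ j := by
    intro J
    induction J with
    | zero => simp [hm0]
    | succ J ih =>
      rw [← Finset.sum_range_add_sum_Ico _ (hm J.lt_succ_self).le, Finset.sum_range_succ]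
      exact add_le_add ih (h J)
  refine summable_of_sum_range_le (c := 2) (fun n => by positivity) fun n => ?_
  refine le_trans ?_ ((h1 n).trans (sum_geometric_two_le n))
  exact Finset.sum_le_sum_of_subset_of_nonneg (Finset.range_mono hm.le_apply)
    fun _ _ _ => by positivity

/-- Blocks of mass at most 2^{-j} have summable total mass, so the pasted sequence stays in l(p)
while its image leaves l₁. -/
theorem exists_gliding_hump_maddoxL (hc : ∀ n k, n < k → c n k = 0) (hp : ∀ k, 0 < p k)
    (hmaps : ∀ y ∈ maddoxL 𝕜 p, triApply c y ∈ ellOne 𝕜)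
    (h : ∀ j N (M : ℝ≥0∞), M ≠ ∞ → ∃ (z : ℕ → 𝕜) (G : Finset ℕ),
      ∑ k ∈ G, ‖z k‖ ^ p k ≤ (1 / 2) ^ j ∧ (∀ k ∈ G, N ≤ k) ∧ (∀ k ∉ G, z k = 0) ∧
      M < lnorm (triApply c z)) : False := by
  obtain ⟨y, m, hm, hm0, hP, hy⟩ := exists_gliding_hump hc (column_ne_top hc hp hmaps)
    (P := fun j z => ∀ F : Finset ℕ, ∑ k ∈ F, ‖z k‖ ^ p k ≤ (1 / 2) ^ j) fun j N M hM => by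
      obtain ⟨z, G, h1, h2, h3, h4⟩ := h j N M hM
      refine ⟨z, G.sup id + 1, fun F => ?_, fun k hk => h3 k fun hG => ?_,
        fun k hk => h3 k fun hG => ?_, h4⟩
      · refine le_trans ?_ h1
        rw [← Finset.sum_filter_of_ne (p := (· ∈ G)) fun k _ hk => by
          by_contra hG
          exact hk (by rw [h3 k hG, norm_zero, Real.zero_rpow (hp k).ne'])]
        exact Finset.sum_le_sum_of_subset_of_nonneg (fun k hk => (Finset.mem_filter.1 hk).2)
          fun _ _ _ => by positivity
      · exact absurd (h2 k hG) (not_le.2 hk)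
      · have := Finset.le_sup (f := id) hG
        simp only [id] at this
        omega
  refine mem_ellOne_iff.1 (hmaps y (mem_maddoxL_of_blocks hm hm0 fun j => ?_)) hy
  refine le_trans (Finset.sum_le_sum fun k hk => ?_) (hP j (Finset.Ico (m j) (m (j + 1))))
  simp only [if_pos (Finset.mem_Ico.1 hk), le_refl]

theorem maddoxL_maps_iff_of_le_one (hc : ∀ n k, n < k → c n k = 0) (hp : ∀ k, 0 < p k)
    (hp1 : ∀ k, p k ≤ 1) :
    (∀ y ∈ maddoxL 𝕜 p, triApply c y ∈ ellOne 𝕜) ↔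
      (⨆ (F : Finset ℕ) (_ : F.Nonempty), ⨆ k, ‖∑ n ∈ F, c n k‖ₑ ^ p k) < ∞ := by
  rw [iSup_nonempty_lt_top_iff]
  constructor
  · intro h
    by_contra! hH
    have hcol := column_ne_top hc hp h
    refine exists_gliding_hump_maddoxL hc hp h fun j N M hM => ?_
    set R : ℝ := M.toReal + 1
    have hR : 1 ≤ R := le_add_of_nonneg_left ENNReal.toReal_nonneg
    -- A dominates the values from columns below N, so a value above A must come from some k ≥ N.
    -- One spike there, of mass 2^{-j}, is the whole block.
    set A : ℝ≥0∞ := ∑ k ∈ Finset.range N, lnorm (column c k) ^ p k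
    have hA : A ≠ ∞ := (ENNReal.sum_lt_top.2 fun k _ =>
      ENNReal.rpow_lt_top_of_nonneg (hp k).le (hcol k)).ne
    obtain ⟨F, -, hF⟩ := hH (A + ENNReal.ofReal (2 ^ j * R))
      (ENNReal.add_ne_top.2 ⟨hA, ENNReal.ofReal_ne_top⟩)
    obtain ⟨k, hk⟩ := lt_iSup_iff.1 hF
    set d := ∑ n ∈ F, c n k
    have hdcol : ‖d‖ₑ ≤ lnorm (column c k) := enorm_sum_le_lnorm (column c k) F
    have hNk : N ≤ k := by
      by_contra! hlt
      refine absurd hk (not_lt.2 ?_)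
      calc ‖d‖ₑ ^ p k ≤ lnorm (column c k) ^ p k := ENNReal.rpow_le_rpow hdcol (hp k).le
        _ ≤ A := Finset.single_le_sum (f := fun k => lnorm (column c k) ^ p k)
            (fun _ _ => zero_le) (Finset.mem_range.2 hlt)
        _ ≤ _ := le_self_add
    have hd : 2 ^ j * R < ‖d‖ ^ p k := by
      have h1 := (le_add_self.trans_lt hk : ENNReal.ofReal (2 ^ j * R) < _)
      rw [← ofReal_norm, ENNReal.ofReal_rpow_of_nonneg (norm_nonneg _) (hp k).le] at h1
      exact (ENNReal.ofReal_lt_ofReal_iff_of_nonneg (by positivity)).1 h1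
    set l : ℝ := ((1 / 2 : ℝ) ^ j) ^ (p k)⁻¹
    have hl : 0 < l := by positivity
    have hlp : l ^ p k = (1 / 2) ^ j := Real.rpow_inv_rpow (by positivity) (hp k).ne'
    refine ⟨Pi.single k (l : 𝕜), {k}, ?_, ?_, ?_, ?_⟩
    · simp [abs_of_pos hl, hlp]
    · simpa using hNk
    · exact fun i hi => Pi.single_eq_of_ne (by simpa using hi) _
    · have h2 : R < l * ‖d‖ := by
        rw [← Real.rpow_lt_rpow_iff (by positivity) (by positivity) (hp k),
          Real.mul_rpow hl.le (norm_nonneg _), hlp]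
        -- R ≥ 1 and p_k ≤ 1 give R^{p_k} ≤ R.
        calc R ^ p k ≤ R ^ (1 : ℝ) := Real.rpow_le_rpow_of_exponent_le hR (hp1 k)
          _ = (1 / 2) ^ j * (2 ^ j * R) := by
            rw [Real.rpow_one, ← mul_assoc, ← mul_pow]; norm_num
          _ < _ := by gcongr
      rw [triApply_single hc, lnorm_smul]
      calc M = ENNReal.ofReal M.toReal := (ENNReal.ofReal_toReal hM).symm
        _ < ENNReal.ofReal (l * ‖d‖) :=
          (ENNReal.ofReal_lt_ofReal_iff ((one_pos.trans_le hR).trans h2)).2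
            ((lt_add_one _).trans h2)
        _ = ‖(l : 𝕜)‖ₑ * ‖d‖ₑ := by
          rw [ENNReal.ofReal_mul hl.le, ← ofReal_norm (l : 𝕜), ← ofReal_norm d, RCLike.norm_ofReal,
            abs_of_pos hl]
        _ ≤ _ := by gcongr
  · rintro ⟨M, hM, h⟩ y hy
    have hMk : ∀ k, lnorm (column c k) ≤ 4 * M ^ (p k)⁻¹ := fun k => by
      refine lnorm_le_of_forall_enorm_sum_le fun F => ?_
      rcases F.eq_empty_or_nonempty with rfl | hF
      · simp
      · rw [← ENNReal.rpow_le_rpow_iff (hp k), ENNReal.rpow_inv_rpow (hp k).ne']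
        exact (le_iSup (fun k => ‖∑ n ∈ F, c n k‖ₑ ^ p k) k).trans (h F hF)
    -- The terms are 4(|y_k|^{p_k} M)^{1/p_k}. The base is eventually below 1 and the exponent is at
    -- least 1, so a multiple of |y_k|^{p_k} dominates.
    have hsum : Summable fun k => ‖y k‖ * (4 * M.toReal ^ (p k)⁻¹) := by
      have hy' : Summable fun k => ‖y k‖ ^ p k := hy
      have h1 := hy'.mul_right M.toReal
      refine Summable.of_norm_bounded_eventually_nat (h1.mul_left 4) ?_
      filter_upwards [(tendsto_order.1 h1.tendsto_atTop_zero).2 1 one_pos] with k hk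
      have h2 : 0 ≤ ‖y k‖ ^ p k * M.toReal := by positivity
      rw [Real.norm_of_nonneg (by positivity)]
      calc ‖y k‖ * (4 * M.toReal ^ (p k)⁻¹) = 4 * (‖y k‖ ^ p k * M.toReal) ^ (p k)⁻¹ := by
            rw [Real.mul_rpow (by positivity) ENNReal.toReal_nonneg,
              Real.rpow_rpow_inv (norm_nonneg _) (hp k).ne']
            ring
        _ ≤ 4 * (‖y k‖ ^ p k * M.toReal) ^ (1 : ℝ) := by
            gcongr 4 * ?_
            exact Real.rpow_le_rpow_of_exponent_ge_of_imp h2 hk.le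
              ((one_le_inv₀ (hp k)).2 (hp1 k)) (by simp [(hp k).ne'])
        _ = _ := by rw [Real.rpow_one]
    rw [mem_ellOne_iff]
    refine ne_top_of_le_ne_top hsum.tsum_ofReal_ne_top (lnorm_triApply_le hc fun N => ?_)
    refine (lnorm_sum_le _ _).trans ((Finset.sum_le_sum fun k _ => ?_).trans
      (ENNReal.sum_le_tsum (Finset.range N)))
    rw [lnorm_smul, ENNReal.ofReal_mul (norm_nonneg _), ofReal_norm]
    gcongr
    refine (hMk k).trans_eq ?_
    rw [ENNReal.ofReal_mul (by norm_num), ← ENNReal.ofReal_rpow_of_nonneg ENNReal.toReal_nonneg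
      (inv_nonneg.2 (hp k).le), ENNReal.ofReal_toReal hM]
    norm_num

theorem maddoxL_maps_iff_of_one_lt (hc : ∀ n k, n < k → c n k = 0) (hp1 : ∀ k, 1 < p k) :
    (∀ y ∈ maddoxL 𝕜 p, triApply c y ∈ ellOne 𝕜) ↔ ∃ L : ℕ, 1 ≤ L ∧
      (⨆ (F : Finset ℕ) (_ : F.Nonempty), ∑' k,
        ‖∑ n ∈ F, c n k * (L : 𝕜)⁻¹‖ₑ ^ (p k / (p k - 1))) < ∞ := by
  have hp : ∀ k, 0 < p k := fun k => one_pos.trans (hp1 k)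
  have hconj : ∀ k, (p k).HolderConjugate (p k / (p k - 1)) := fun k =>
    Real.HolderConjugate.conjExponent (hp1 k)
  simp only [iSup_nonempty_lt_top_iff]
  constructor
  · intro h
    by_contra! hH
    have hcol := column_ne_top hc hp h
    refine exists_gliding_hump_maddoxL hc hp h fun j N M hM => ?_
    -- The block built below has image with a finite subsum equal to L·2^{-j}, and this L makes it
    -- exceed M.
    obtain ⟨L, hL⟩ := exists_nat_ge ((M.toReal + 1) * 2 ^ j)
    have hL1 : 1 ≤ L := by
      have h2 : (1 : ℝ) ≤ (M.toReal + 1) * 2 ^ j :=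
        one_le_mul_of_one_le_of_one_le (le_add_of_nonneg_left ENNReal.toReal_nonneg)
          (one_le_pow₀ one_le_two)
      exact_mod_cast h2.trans hL
    have hL0 : (L : 𝕜) ≠ 0 := by exact_mod_cast (by omega : L ≠ 0)
    set A : ℝ≥0∞ := ∑ k ∈ Finset.range N, lnorm (column c k) ^ (p k / (p k - 1))
    have hA : A ≠ ∞ := (ENNReal.sum_lt_top.2 fun k _ =>
      ENNReal.rpow_lt_top_of_nonneg (hconj k).symm.nonneg (hcol k)).ne
    -- The surplus 1 over A makes the part S over k ≥ N exceed 1, hence μ ≤ 1 below.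
    obtain ⟨F, -, hF⟩ := hH L hL1 (A + 1) (by simp [hA])
    set d : ℕ → 𝕜 := fun k => ∑ n ∈ F, c n k * (L : 𝕜)⁻¹ with hd
    have hd0 : ∀ k, F.sup id < k → d k = 0 := fun k hk => Finset.sum_eq_zero fun n hn => by
      rw [hc n k (lt_of_le_of_lt (Finset.le_sup (f := id) hn) hk), zero_mul]
    have hdcol : ∀ k, ‖d k‖ₑ ≤ lnorm (column c k) := fun k => by
      have h1 : ‖(L : 𝕜)⁻¹‖ₑ ≤ 1 := by
        rw [← ofReal_norm, norm_inv, RCLike.norm_natCast]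
        exact ENNReal.ofReal_le_one.2 (inv_le_one_of_one_le₀ (by exact_mod_cast hL1))
      rw [hd]
      simp only [← Finset.sum_mul, enorm_mul]
      exact (mul_le_mul' (enorm_sum_le_lnorm (column c k) F) h1).trans_eq (mul_one _)
    set G : Finset ℕ := Finset.Ico N (F.sup id + 1)
    set S : ℝ := ∑ k ∈ G, ‖d k‖ ^ (p k / (p k - 1)) with hSdef
    have hS : 1 < S := by
      have h1 : ∑' k, ‖d k‖ₑ ^ (p k / (p k - 1))
          ≤ A + ∑ k ∈ G, ‖d k‖ₑ ^ (p k / (p k - 1)) := by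
        rw [tsum_eq_sum (s := Finset.range N ∪ G)]
        · rw [Finset.sum_union (Finset.disjoint_left.2 fun k h1 h2 => absurd (Finset.mem_range.1 h1)
            (not_lt.2 (Finset.mem_Ico.1 h2).1))]
          exact add_le_add (Finset.sum_le_sum fun k _ =>
            ENNReal.rpow_le_rpow (hdcol k) (hconj k).symm.nonneg) le_rfl
        · intro k hk
          simp only [G, Finset.mem_union, Finset.mem_range, Finset.mem_Ico] at hk
          rw [hd0 k (by omega), enorm_zero, ENNReal.zero_rpow_of_pos (hconj k).symm.pos]
      have h2 := (ENNReal.add_lt_add_iff_left hA).1 (hF.trans_le h1)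
      have h3 : ∑ k ∈ G, ‖d k‖ₑ ^ (p k / (p k - 1)) = ENNReal.ofReal S := by
        rw [hSdef, ENNReal.ofReal_sum_of_nonneg fun _ _ => by positivity]
        refine Finset.sum_congr rfl fun k _ => ?_
        rw [← ofReal_norm, ENNReal.ofReal_rpow_of_nonneg (norm_nonneg _) (hconj k).symm.nonneg]
      rw [h3] at h2
      exact ENNReal.one_lt_ofReal.1 h2
    have hS0 : 0 < S := one_pos.trans hS
    set μ : ℝ := (1 / 2) ^ j / S
    have hμ0 : 0 < μ := by positivity
    have hμ1 : μ ≤ 1 := div_le_one_of_le₀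
      ((pow_le_one₀ (by norm_num) (by norm_num)).trans hS.le) hS0.le
    set w : ℕ → 𝕜 := fun k => star (d k) / (‖d k‖ : 𝕜)
    have hw : ∀ k, ‖w k‖ ≤ 1 := fun k => by
      simp only [w]
      rw [norm_div, norm_star, RCLike.norm_ofReal, abs_norm]
      exact div_self_le_one _
    have hwd : ∀ k, w k * d k = (‖d k‖ : 𝕜) := fun k => by
      rcases eq_or_ne (d k) 0 with h0 | h0
      · simp [h0]
      · have : (‖d k‖ : 𝕜) ≠ 0 := by simpa using h0
        rw [div_mul_eq_mul_div, div_eq_iff this, RCLike.star_def, RCLike.conj_mul, sq]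
    have hexp : ∀ k, p k / (p k - 1) - 1 = (p k - 1)⁻¹ := fun k => by
      have := sub_pos.2 (hp1 k)
      field_simp
      ring
    -- This is the equality case of Hölder, scaled by μ = 2^{-j}/S. As μ ≤ 1 and p_k > 1, μ^{p_k} ≤
    -- μ bounds the mass by μS = 2^{-j}, whereas pairing with L·d gives LμS.
    set z : ℕ → 𝕜 := fun k =>
      if k ∈ G then ((μ * ‖d k‖ ^ (p k - 1)⁻¹ : ℝ) : 𝕜) * w k else 0
    refine ⟨z, G, ?_, fun k hk => (Finset.mem_Ico.1 hk).1, fun k hk => if_neg hk, ?_⟩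
    · calc ∑ k ∈ G, ‖z k‖ ^ p k ≤ ∑ k ∈ G, μ * ‖d k‖ ^ (p k / (p k - 1)) := by
            refine Finset.sum_le_sum fun k hk => ?_
            have h1 : ‖z k‖ ≤ μ * ‖d k‖ ^ (p k - 1)⁻¹ := by
              simp only [z, if_pos hk, norm_mul, RCLike.norm_ofReal]
              rw [abs_of_nonneg (by positivity)]
              exact mul_le_of_le_one_right (by positivity) (hw k)
            calc ‖z k‖ ^ p k ≤ (μ * ‖d k‖ ^ (p k - 1)⁻¹) ^ p k :=
                  Real.rpow_le_rpow (norm_nonneg _) h1 (hp k).le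
              _ = μ ^ p k * ‖d k‖ ^ (p k / (p k - 1)) := by
                  rw [Real.mul_rpow hμ0.le (by positivity), ← Real.rpow_mul (norm_nonneg _),
                    inv_mul_eq_div]
              _ ≤ μ ^ (1 : ℝ) * ‖d k‖ ^ (p k / (p k - 1)) := by
                  gcongr ?_ * _
                  exact Real.rpow_le_rpow_of_exponent_ge hμ0 hμ1 (hp1 k).le
              _ = _ := by rw [Real.rpow_one]
        _ = (1 / 2) ^ j := by
            rw [← Finset.mul_sum, ← hSdef, div_mul_cancel₀ _ hS0.ne']
    · have hval : ∑ n ∈ F, triApply c z n = ((L * (1 / 2) ^ j : ℝ) : 𝕜) := by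
        rw [triApply_eq_sum_column hc (F := G) fun k hk => if_neg hk]
        simp only [Finset.sum_apply, Pi.smul_apply, smul_eq_mul, column]
        rw [Finset.sum_comm]
        have h1 : ∀ k ∈ G, ∑ n ∈ F, z k * c n k
            = ((L * (μ * ‖d k‖ ^ (p k / (p k - 1))) : ℝ) : 𝕜) := fun k hk => by
          have h2 : ∑ n ∈ F, z k * c n k = z k * (L * d k) := by
            simp only [hd, ← Finset.sum_mul, ← Finset.mul_sum]
            field_simp
          have h3 : ‖d k‖ ^ (p k / (p k - 1)) = ‖d k‖ ^ (p k - 1)⁻¹ * ‖d k‖ := by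
            rw [← hexp, ← Real.rpow_add_one' (norm_nonneg _), sub_add_cancel]
            rw [sub_add_cancel]
            exact (hconj k).symm.pos.ne'
          rw [h2, h3]
          simp only [z, if_pos hk]
          push_cast
          linear_combination (μ : 𝕜) * ((‖d k‖ ^ (p k - 1)⁻¹ : ℝ) : 𝕜) * L * hwd k
        rw [Finset.sum_congr rfl h1, ← RCLike.ofReal_sum, ← Finset.mul_sum, ← Finset.mul_sum,
          ← hSdef, div_mul_cancel₀ _ hS0.ne']
      calc M = ENNReal.ofReal M.toReal := (ENNReal.ofReal_toReal hM).symm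
        _ < ENNReal.ofReal (L * (1 / 2) ^ j) := by
          refine (ENNReal.ofReal_lt_ofReal_iff (by positivity)).2 ((lt_add_one _).trans_le ?_)
          rwa [one_div, inv_pow, ← div_eq_mul_inv, le_div_iff₀ (by positivity)]
        _ = ‖∑ n ∈ F, triApply c z n‖ₑ := by
          rw [hval, ← ofReal_norm, RCLike.norm_ofReal, abs_of_nonneg (by positivity)]
        _ ≤ _ := enorm_sum_le_lnorm _ _
  · rintro ⟨L, hL, M, hM, h⟩ y hy
    have hL0 : (L : 𝕜) ≠ 0 := by exact_mod_cast (by omega : L ≠ 0)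
    have hy' : ∑' k, ‖y k‖ₑ ^ p k ≠ ∞ := by
      have h1 : Summable fun k => ‖y k‖ ^ p k := hy
      convert h1.tsum_ofReal_ne_top using 4 with k
      rw [← ofReal_norm, ENNReal.ofReal_rpow_of_nonneg (norm_nonneg _) (hp k).le]
    rw [mem_ellOne_iff]
    refine ne_top_of_le_ne_top (b := 4 * (‖(L : 𝕜)‖ₑ * (∑' k, ‖y k‖ₑ ^ p k + M)))
      (ENNReal.mul_ne_top (by simp) (ENNReal.mul_ne_top enorm_ne_top (by simp [hy', hM])))
      (lnorm_le_of_forall_enorm_sum_le fun F => ?_)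
    rcases F.eq_empty_or_nonempty with rfl | hF
    · simp
    set K := Finset.range (F.sup id + 1)
    have h1 : ∑ n ∈ F, triApply c y n = ∑ k ∈ K, (L : 𝕜) * (y k * ∑ n ∈ F, c n k * (L : 𝕜)⁻¹) := by
      have h2 : ∀ n ∈ F, triApply c y n = ∑ k ∈ K, c n k * y k := fun n hn => by
        have := Finset.le_sup (f := id) hn
        simp only [id] at this
        refine Finset.sum_subset (Finset.range_mono (by omega)) fun k _ hk => ?_
        rw [hc n k (by simpa using hk), zero_mul]
      rw [Finset.sum_congr rfl h2, Finset.sum_comm]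
      refine Finset.sum_congr rfl fun k _ => ?_
      simp only [← Finset.sum_mul]
      field_simp
    -- Young's inequality with the divisors p_k and p_k', both at least 1, dropped.
    have young : ∀ k (a b : ℝ≥0∞), a * b ≤ a ^ p k + b ^ (p k / (p k - 1)) := fun k a b => by
      refine (ENNReal.young_inequality a b (hconj k)).trans (add_le_add ?_ ?_) <;>
      refine ENNReal.div_le_of_le_mul (le_mul_of_one_le_right zero_le ?_)
      · exact ENNReal.one_le_ofReal.2 (hp1 k).le
      · exact ENNReal.one_le_ofReal.2 (hconj k).symm.lt.le
    calc ‖∑ n ∈ F, triApply c y n‖ₑ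
        ≤ ∑ k ∈ K, ‖(L : 𝕜)‖ₑ * (‖y k‖ₑ ^ p k
            + ‖∑ n ∈ F, c n k * (L : 𝕜)⁻¹‖ₑ ^ (p k / (p k - 1))) := by
          rw [h1]
          refine (enorm_sum_le _ _).trans (Finset.sum_le_sum fun k _ => ?_)
          rw [enorm_mul, enorm_mul]
          gcongr
          exact young k _ _
      _ ≤ ‖(L : 𝕜)‖ₑ * (∑' k, ‖y k‖ₑ ^ p k + M) := by
          rw [← Finset.mul_sum, Finset.sum_add_distrib]
          gcongr
          · exact ENNReal.sum_le_tsum _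
          · exact (ENNReal.sum_le_tsum _).trans (h F hF)

end MaddoxL

/-- The α-dual of `X(r, s, t; B)`, as the set of `a` whose triangle `c_{nk}(a)` maps `X` to `l₁`. -/
theorem mem_alphaDual_domain_iff {𝕜 : Type*} [RCLike 𝕜] {r s t : ℕ → 𝕜} {u : 𝕜} (v : 𝕜)
    (hr : ∀ n, r n ≠ 0) (ht : ∀ n, t n ≠ 0) (hs : s 0 ≠ 0) (hu : u ≠ 0) (X : Set (ℕ → 𝕜))
    (a : ℕ → 𝕜) :
    a ∈ alphaDual (domain X r s t u v) ↔
      ∀ y ∈ X, triApply (dualEntry r s t u v a) y ∈ ellOne 𝕜 := by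
  have key : ∀ x, (fun n => a n * x n)
      = triApply (dualEntry r s t u v a) (transform r s t u v x) := fun x =>
    funext fun n => mul_eq_sum_dualEntry v hr ht hs hu a x n
  constructor
  · intro h y hy
    obtain ⟨x, rfl⟩ := exists_transform_eq v hr ht hs hu y
    rw [← key]
    exact h x hy
  · intro h x hx
    rw [key]
    exact h _ hx

end GenMeanDiff

theorem theorem4p4 {𝕜 : Type*} [RCLike 𝕜] (r s t : ℕ → 𝕜) (u v : 𝕜) (p : ℕ → ℝ)
    (hr : ∀ n, r n ≠ 0) (ht : ∀ n, t n ≠ 0) (hs : s 0 ≠ 0) (hu : u ≠ 0) (hv : v ≠ 0)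
    (hp : ∀ k, 0 < p k) (hpb : BddAbove (Set.range p)) :
    ((∀ k, 1 < p k) →
      GenMeanDiff.alphaDual (GenMeanDiff.domain (GenMeanDiff.maddoxL 𝕜 p) r s t u v)
        = GenMeanDiff.H5 r s t u v p) ∧
    ((∀ k, p k ≤ 1) →
      GenMeanDiff.alphaDual (GenMeanDiff.domain (GenMeanDiff.maddoxL 𝕜 p) r s t u v)
        = GenMeanDiff.H4 r s t u v p) ∧
    GenMeanDiff.alphaDual (GenMeanDiff.domain (GenMeanDiff.maddoxC0 𝕜 p) r s t u v)
      = GenMeanDiff.H1 r s t u v p ∧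
    GenMeanDiff.alphaDual (GenMeanDiff.domain (GenMeanDiff.maddoxC 𝕜 p) r s t u v)
      = GenMeanDiff.H1 r s t u v p ∩ GenMeanDiff.H2 r s t u v ∧
    GenMeanDiff.alphaDual (GenMeanDiff.domain (GenMeanDiff.maddoxLInf 𝕜 p) r s t u v)
      = GenMeanDiff.H3 r s t u v p := by
  have hc := fun (a : ℕ → 𝕜) n k (h : n < k) => GenMeanDiff.dualEntry_eq_zero r s t u v a h
  refine ⟨fun hp1 => ?_, fun hp1 => ?_, ?_, ?_, ?_⟩ <;> ext a <;>
    rw [GenMeanDiff.mem_alphaDual_domain_iff v hr ht hs hu]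
  · exact GenMeanDiff.maddoxL_maps_iff_of_one_lt (hc a) hp1
  · exact GenMeanDiff.maddoxL_maps_iff_of_le_one (hc a) hp hp1
  · exact GenMeanDiff.maddoxC0_maps_iff (hc a) hp
  · exact (GenMeanDiff.maddoxC_maps_iff hp).trans
      (and_congr (GenMeanDiff.maddoxC0_maps_iff (hc a) hp) Iff.rfl)
  · exact GenMeanDiff.maddoxLInf_maps_iff (hc a) hp
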